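/- Theorem. Fix a field $\mathbb{F}$ and let $\mathbf{Vec}$ be the category of finite-dimensional $\mathbb{F}$-vector spaces and linear maps. Let $F : (\mathbb{R},\le) \to \mathbf{Vec}$ be a functor (a diagram). For an interval $I \subseteq \mathbb{R}$ (possibly empty, possibly unbounded, with or without its endpoints), let $\chi_I : (\mathbb{R},\le)\to\mathbf{Vec}$ be the diagram with $\chi_I(a) = \mathbb{F}$ if $a \in I$ and $\chi_I(a) = 0$ otherwise, and with $\chi_I(a \le b) = \mathrm{Id}_{\mathbb{F}}$ if $a,b \in I$ and $\chi_I(a\le b) = 0$ otherwise. Say that $F$ is constant on an interval $I$ if $F(a\le b)$ is an isomorphism for all $a \le b$ in $I$; call $a \in \mathbb{R}$ a regular value of $F$ if $F$ is constant on some open interval containing $a$, and a critical value of $F$ otherwise. Call $F$ tame if it has only finitely many critical values, and of finite type if there are an integer $N \ge 0$ and intervals $I_1,\dots,I_N \subseteq \mathbb{R}$ with $F \cong \bigoplus_{k=1}^N \chi_{I_k}$ as diagrams. Then $F$ is tame if and only if $F$ has finite type. -/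

import Mathlib

open CategoryTheory CategoryTheory.Limits

noncomputable section

namespace Persistence

universe u

/-- The category of diagrams of finite-dimensional `K`-vector spaces indexed by the
poset `(ℝ, ≤)`: functors from `ℝ`, viewed as a preorder category. -/
abbrev Diagram (K : Type u) [Field K] := ℝ ⥤ FGModuleCat.{u} K

/-- Diagrams form an abelian category, so they have finite direct sums. -/
instance instHasFiniteBiproductsDiagram (K : Type u) [Field K] :
    HasFiniteBiproducts (Diagram K) :=
  Abelian.hasFiniteBiproducts

section IntervalDiagram

variable (K : Type u) [Field K] (I : Set ℝ)

open scoped Classical in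
/-- The vector space of the interval diagram at `a`: all of `K` if `a ∈ I`, zero otherwise. -/
def intervalSpace (a : ℝ) : Submodule K K :=
  if a ∈ I then ⊤ else ⊥

variable {I} in
theorem intervalSpace_of_mem {a : ℝ} (ha : a ∈ I) : intervalSpace K I a = ⊤ :=
  if_pos ha

variable {I} in
theorem intervalSpace_of_notMem {a : ℝ} (ha : a ∉ I) : intervalSpace K I a = ⊥ :=
  if_neg ha

open scoped Classical in
/-- The structure map of the interval diagram from `a` to `b`: the identity of `K`
if `a` and `b` both lie in `I`, zero otherwise. -/
def intervalMap (a b : ℝ) : intervalSpace K I a →ₗ[K] intervalSpace K I b :=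
  if h : a ∈ I ∧ b ∈ I then
    Submodule.inclusion
      ((intervalSpace_of_mem K h.1).trans (intervalSpace_of_mem K h.2).symm).le
  else 0

variable {I} in
theorem coe_intervalMap {a b : ℝ} (ha : a ∈ I) (hb : b ∈ I) (x : intervalSpace K I a) :
    (intervalMap K I a b x : K) = x := by
  simp [intervalMap, ha, hb]

variable {I} in
theorem intervalMap_eq_zero {a b : ℝ} (h : ¬ (a ∈ I ∧ b ∈ I)) : intervalMap K I a b = 0 :=
  dif_neg h

theorem intervalMap_self (a : ℝ) : intervalMap K I a a = LinearMap.id := by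
  ext x
  by_cases ha : a ∈ I
  · exact coe_intervalMap K ha ha x
  · have hx : (x : K) = 0 :=
      (Submodule.mem_bot K).1 ((intervalSpace_of_notMem K ha).le x.2)
    rw [intervalMap_eq_zero K (fun h => ha h.1)]
    simp [hx]

theorem intervalMap_comp (hI : I.OrdConnected) {a b c : ℝ} (hab : a ≤ b) (hbc : b ≤ c) :
    intervalMap K I a c = (intervalMap K I b c).comp (intervalMap K I a b) := by
  ext x
  by_cases h : a ∈ I ∧ c ∈ I
  · have hb : b ∈ I := hI.out h.1 h.2 ⟨hab, hbc⟩
    rw [coe_intervalMap K h.1 h.2, LinearMap.comp_apply, coe_intervalMap K hb h.2,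
      coe_intervalMap K h.1 hb]
  · rw [intervalMap_eq_zero K h, LinearMap.comp_apply]
    by_cases ha : a ∈ I ∧ b ∈ I
    · rw [intervalMap_eq_zero K (a := b) (b := c) (fun h' => h ⟨ha.1, h'.2⟩)]
      simp
    · rw [intervalMap_eq_zero K ha]
      simp

/-- The interval diagram `χ_I` of an interval `I ⊆ ℝ`, that is, of an order-connected
subset (possibly empty, possibly unbounded, with or without its endpoints). -/
def intervalDiagram (hI : I.OrdConnected) : Diagram K where
  obj a := FGModuleCat.of K (intervalSpace K I a)
  map {a b} _ := FGModuleCat.ofHom (intervalMap K I a b)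
  map_id a := by
    rw [intervalMap_self]
    rfl
  map_comp f g := by
    rw [intervalMap_comp K I hI (leOfHom f) (leOfHom g)]
    rfl

end IntervalDiagram

section Tame

variable {K : Type u} [Field K] (F : Diagram K)

/-- `F` is constant on `I` if `F(a ≤ b)` is an isomorphism for all `a ≤ b` in `I`. -/
def IsConstantOn (I : Set ℝ) : Prop :=
  ∀ ⦃a b : ℝ⦄ (h : a ≤ b), a ∈ I → b ∈ I → IsIso (F.map (homOfLE h))

/-- `a` is a regular value of `F` if `F` is constant on some open interval containing `a`. -/
def IsRegularValue (a : ℝ) : Prop :=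
  ∃ I : Set ℝ, I.OrdConnected ∧ IsOpen I ∧ a ∈ I ∧ IsConstantOn F I

/-- `a` is a critical value of `F` if it is not a regular value. -/
def IsCriticalValue (a : ℝ) : Prop :=
  ¬ IsRegularValue F a

/-- `F` is tame if it has only finitely many critical values. -/
def IsTame : Prop :=
  {a : ℝ | IsCriticalValue F a}.Finite

/-- `F` has finite type if it is isomorphic, as a diagram, to a finite direct sum of
interval diagrams. -/
def HasFiniteType : Prop :=
  ∃ (N : ℕ) (I : Fin N → Set ℝ) (hI : ∀ k, (I k).OrdConnected),
    Nonempty (F ≅ ⨁ fun k => intervalDiagram K (I k) (hI k))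

end Tame

end Persistence

end

namespace Persistence

universe u v w

/-! ### Extending a functor on `ℝ` along a monotone level function. -/

section Slide

variable {C : Type v} [Category.{w} C] (F : ℝ ⥤ C)

/-! Finitely many critical values cut `ℝ` into finitely many pieces, the critical points and the
gaps between them, and `F` inverts every arrow inside a piece. A monotone `r : ℝ → ℕ` numbers the
pieces (`IsTame.exists_monotone`). By `exists_slide` vectors can then be moved from `a` to `b`
whenever `r a ≤ r b`, so `F` behaves like a representation of a finite chain.

Such a representation splits off intervals. Push a nonzero vector of lowest level forward until it
dies; on its support `I`, pull back a functional equal to 1 on the vector at the last level where it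
survives. Vector and functional make `χ_I` a retract of `F` (`exists_retract_of_ne_zero`). The
complement again inverts arrows inside pieces and has smaller total dimension over the levels, so
induction finishes (`HasFiniteType.of_monotone`).

Conversely, an interval has at most two frontier points, and off the frontiers of the finitely many
summands the sum is locally constant. -/

theorem isIso_map_trans {a b c : ℝ} (hab : a ≤ b) (hbc : b ≤ c)
    [IsIso (F.map (homOfLE hab))] [IsIso (F.map (homOfLE hbc))] :
    IsIso (F.map (homOfLE (hab.trans hbc))) := by
  rw [← homOfLE_comp hab hbc, F.map_comp]
  infer_instance

theorem isIso_map_of_isIso_map_left {a b c : ℝ} (hab : a ≤ b) (hbc : b ≤ c)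
    [IsIso (F.map (homOfLE hab))] [h : IsIso (F.map (homOfLE (hab.trans hbc)))] :
    IsIso (F.map (homOfLE hbc)) := by
  rw [← homOfLE_comp hab hbc, F.map_comp] at h
  exact IsIso.of_isIso_comp_left (F.map (homOfLE hab)) _

theorem isIso_map_of_isIso_map_right {a b c : ℝ} (hab : a ≤ b) (hbc : b ≤ c)
    [IsIso (F.map (homOfLE hbc))] [h : IsIso (F.map (homOfLE (hab.trans hbc)))] :
    IsIso (F.map (homOfLE hab)) := by
  rw [← homOfLE_comp hab hbc, F.map_comp] at h
  exact IsIso.of_isIso_comp_right _ (F.map (homOfLE hbc))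

/-- A functor on `ℝ` that inverts every arrow inside a level set of a monotone function `r`
extends to the preorder on `ℝ` pulled back along `r`. -/
theorem exists_slide {r : ℝ → ℕ} (hr : Monotone r)
    (hF : ∀ ⦃a b : ℝ⦄ (h : a ≤ b), r a = r b → IsIso (F.map (homOfLE h))) :
    ∃ T : ∀ a b : ℝ, r a ≤ r b → (F.obj a ⟶ F.obj b),
      (∀ a b h (hab : a ≤ b), T a b h = F.map (homOfLE hab)) ∧
      ∀ a b c hab hbc, T a b hab ≫ T b c hbc = T a c (hab.trans hbc) := by
  -- The slide is `F.map` forwards and the inverse of `F.map` backwards; the two properties pin it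
  -- down in both cases and agree when `a = b`.
  have hex : ∀ a b : ℝ, ∃ t : r a ≤ r b → (F.obj a ⟶ F.obj b), ∀ h : r a ≤ r b,
      (∀ hab : a ≤ b, t h = F.map (homOfLE hab)) ∧
      (∀ hba : b ≤ a, t h ≫ F.map (homOfLE hba) = 𝟙 _) := by
    intro a b
    rcases le_total a b with hab | hba
    · refine ⟨fun _ => F.map (homOfLE hab), fun h => ⟨fun _ => rfl, fun hba => ?_⟩⟩
      rw [← F.map_comp, homOfLE_comp]
      exact F.map_id a
    · by_cases h : r a ≤ r b
      · have := hF hba ((hr hba).antisymm h)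
        refine ⟨fun _ => inv (F.map (homOfLE hba)), fun _ => ⟨fun hab => ?_, fun _ => by simp⟩⟩
        refine IsIso.inv_eq_of_hom_inv_id ?_
        rw [← F.map_comp, homOfLE_comp]
        exact F.map_id b
      · exact ⟨fun h' => absurd h' h, fun h' => absurd h' h⟩
  choose T hT using hex
  have hmap : ∀ a b h (hab : a ≤ b), T a b h = F.map (homOfLE hab) := fun a b h => (hT a b h).1
  have hinv : ∀ a b h (hba : b ≤ a), T a b h ≫ F.map (homOfLE hba) = 𝟙 _ := fun a b h => (hT a b h).2
  have hcomp : ∀ {a b c : ℝ} (hab : a ≤ b) (hbc : b ≤ c),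
      F.map (homOfLE hab) ≫ F.map (homOfLE hbc) = F.map (homOfLE (hab.trans hbc)) :=
    fun hab hbc => by rw [← F.map_comp, homOfLE_comp]
  have hinv' : ∀ a b h (hba : b ≤ a), F.map (homOfLE hba) ≫ T a b h = 𝟙 _ := by
    intro a b h hba
    have := hF hba ((hr hba).antisymm h)
    rw [← cancel_mono (F.map (homOfLE hba)), Category.assoc, hinv a b h hba, Category.comp_id,
      Category.id_comp]
  refine ⟨T, hmap, fun a b c hab hbc => ?_⟩
  -- A backward slide is known only through its composite with the forward map, so the composition
  -- law is checked after postcomposing with forward maps inside a level, which can be cancelled.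
  have mono : ∀ {x y : ℝ} (h : x ≤ y), r y ≤ r x → Mono (F.map (homOfLE h)) := fun h h' => by
    have := hF h ((hr h).antisymm h')
    infer_instance
  rcases le_total a b with h1 | h1
  · rw [hmap a b _ h1]
    rcases le_total b c with h2 | h2
    · rw [hmap b c _ h2, hmap a c _ (h1.trans h2), hcomp]
    · rcases le_total a c with h3 | h3
      · rw [hmap a c _ h3, ← hcomp h3 h2, Category.assoc, hinv' b c hbc h2, Category.comp_id]
      · have := mono h3 (hab.trans hbc)
        have := mono h1 (hbc.trans (hr h3))
        rw [← cancel_mono (F.map (homOfLE h3)), hinv a c _ h3,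
          ← cancel_mono (F.map (homOfLE h1)), Category.id_comp, Category.assoc, Category.assoc,
          hcomp, hinv b c hbc h2, Category.comp_id]
  · rcases le_total b c with h2 | h2
    · rw [hmap b c _ h2]
      rcases le_total a c with h3 | h3
      · rw [hmap a c _ h3, ← hcomp h1 h3, ← Category.assoc, hinv a b hab h1, Category.id_comp]
      · have := mono h3 (hab.trans hbc)
        rw [← cancel_mono (F.map (homOfLE h3)), hinv a c _ h3, Category.assoc, hcomp,
          hinv a b hab h1]
    · have := mono (h2.trans h1) (hab.trans hbc)
      rw [← cancel_mono (F.map (homOfLE (h2.trans h1))), hinv a c _ (h2.trans h1), ← hcomp h2 h1,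
        Category.assoc, ← Category.assoc (T b c hbc), hinv b c hbc h2, Category.id_comp,
        hinv a b hab h1]

end Slide

/-! ### From finitely many critical values to a level function. -/

section Regular

variable {K : Type u} [Field K] (F : Diagram K)

/-- Local constancy spreads over the connected set `Set.Icc a b`. The relation `P` ignores the order
of its arguments, so it is symmetric, and two-out-of-three for isomorphisms makes it transitive. -/
theorem isIso_map_of_forall_isRegularValue {a b : ℝ} (hab : a ≤ b)
    (h : ∀ c ∈ Set.Icc a b, IsRegularValue F c) : IsIso (F.map (homOfLE hab)) := by
  let P : ℝ → ℝ → Prop := fun x y =>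
    (∀ hxy : x ≤ y, IsIso (F.map (homOfLE hxy))) ∧ ∀ hyx : y ≤ x, IsIso (F.map (homOfLE hyx))
  have key : P a b := by
    refine isPreconnected_Icc.induction₂ P (fun x hx => ?_) ?_ (fun _ _ _ _ h => h.symm)
      (Set.left_mem_Icc.2 hab) (Set.right_mem_Icc.2 hab)
    · obtain ⟨I, -, hI, hxI, hc⟩ := h x hx
      filter_upwards [mem_nhdsWithin_of_mem_nhds (hI.mem_nhds hxI)] with y hy
      exact ⟨fun hxy => hc hxy hxI hy, fun hyx => hc hyx hy hxI⟩
    · rintro x y z - - - ⟨xy, yx⟩ ⟨yz, zy⟩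
      refine ⟨fun hxz => ?_, fun hzx => ?_⟩
      · rcases le_total x y with h1 | h1
        · have := xy h1
          rcases le_total y z with h2 | h2
          · have := yz h2
            exact isIso_map_trans F h1 h2
          · have := zy h2
            exact isIso_map_of_isIso_map_right F hxz h2
        · have := yx h1
          have := yz (h1.trans hxz)
          exact isIso_map_of_isIso_map_left F h1 hxz
      · rcases le_total x y with h1 | h1
        · have := xy h1
          have := zy (hzx.trans h1)
          exact isIso_map_of_isIso_map_right F hzx h1
        · have := yx h1
          rcases le_total y z with h2 | h2
          · have := yz h2
            exact isIso_map_of_isIso_map_left F h2 hzx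
          · have := zy h2
            exact isIso_map_trans F h2 h1
  exact key.1 hab

/-- A tame diagram is constant on the level sets of a bounded monotone function. -/
theorem IsTame.exists_monotone (hF : IsTame F) :
    ∃ (r : ℝ → ℕ) (m : ℕ), Monotone r ∧ (∀ a, r a < m) ∧
      ∀ ⦃a b : ℝ⦄ (h : a ≤ b), r a = r b → IsIso (F.map (homOfLE h)) := by
  classical
  let C : Finset ℝ := hF.toFinset
  have hlt : Monotone fun a : ℝ => (C.filter (· < a)).card := fun a b h =>
    Finset.card_le_card (Finset.monotone_filter_right _ fun x _ hx => lt_of_lt_of_le hx h)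
  have hle : Monotone fun a : ℝ => (C.filter (· ≤ a)).card := fun a b h =>
    Finset.card_le_card (Finset.monotone_filter_right _ fun x _ hx => le_trans hx h)
  -- Counting critical values both strictly and weakly below `a` isolates each critical point in its
  -- own level. Both counts are monotone, so equal sums force equal counts.
  refine ⟨fun a => (C.filter (· < a)).card + (C.filter (· ≤ a)).card, C.card + C.card + 1,
    hlt.add hle, fun a => ?_, fun a b h hab => ?_⟩
  · exact Nat.lt_succ_of_le (add_le_add (Finset.card_filter_le _ _) (Finset.card_filter_le _ _))
  · have h1 := hlt h
    have h2 := hle h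
    simp only at h1 h2 hab
    have e1 : C.filter (· < a) = C.filter (· < b) := Finset.eq_of_subset_of_card_le
      (Finset.monotone_filter_right _ fun x _ hx => lt_of_lt_of_le hx h) (by omega)
    have e2 : C.filter (· ≤ a) = C.filter (· ≤ b) := Finset.eq_of_subset_of_card_le
      (Finset.monotone_filter_right _ fun x _ hx => le_trans hx h) (by omega)
    rcases h.eq_or_lt with rfl | hlt
    · exact inferInstanceAs (IsIso (F.map (𝟙 a)))
    · refine isIso_map_of_forall_isRegularValue F h fun c hc => ?_
      by_contra hcrit
      have hcC : c ∈ C := hF.mem_toFinset.2 hcrit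
      have hca : c ∈ C.filter (· ≤ a) := e2 ▸ Finset.mem_filter.2 ⟨hcC, hc.2⟩
      -- From `c ≤ a < b`, the strict count at `b` includes `c`, hence so does the one at `a`,
      -- against `a ≤ c`.
      have hca' : c ∈ C.filter (· < a) := by
        rw [e1]
        exact Finset.mem_filter.2 ⟨hcC, (Finset.mem_filter.1 hca).2.trans_lt hlt⟩
      exact absurd hc.1 (not_le.2 (Finset.mem_filter.1 hca').2)

end Regular

/-! ### Splitting off one interval diagram. -/

section Retract

variable {K : Type u} [Field K] (F : Diagram K)

/-- The linear map underlying a structure map of a diagram. -/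
def transition {a b : ℝ} (h : a ≤ b) : F.obj a →ₗ[K] F.obj b :=
  (F.map (homOfLE h)).hom.hom

/-- A coherent family of vectors and a coherent family of functionals, both supported on an
interval and paired to one there, exhibit the interval diagram as a retract. -/
theorem exists_retract_intervalDiagram {I : Set ℝ} (hI : I.OrdConnected)
    (x : ∀ a, F.obj a) (φ : ∀ a, F.obj a →ₗ[K] K)
    (hx0 : ∀ a, a ∉ I → x a = 0) (hφ0 : ∀ a, a ∉ I → φ a = 0)
    (hx : ∀ ⦃a b⦄ (h : a ≤ b), a ∈ I → transition F h (x a) = x b)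
    (hφ : ∀ ⦃a b⦄ (h : a ≤ b), b ∈ I → φ b ∘ₗ transition F h = φ a)
    (h1 : ∀ a ∈ I, φ a (x a) = 1) :
    ∃ (i : intervalDiagram K I hI ⟶ F) (p : F ⟶ intervalDiagram K I hI), i ≫ p = 𝟙 _ ∧
      ∀ a ∈ I, x a ∈ LinearMap.range (i.app a).hom.hom := by
  have hmem : ∀ a v, φ a v ∈ intervalSpace K I a := fun a v => by
    by_cases ha : a ∈ I
    · simp [intervalSpace_of_mem K ha]
    · simp [hφ0 a ha]
  have hzero : ∀ a, a ∉ I → ∀ c : intervalSpace K I a, (c : K) = 0 := fun a ha c =>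
    (Submodule.mem_bot K).1 ((intervalSpace_of_notMem K ha).le c.2)
  let i : intervalDiagram K I hI ⟶ F :=
    { app := fun a => FGModuleCat.ofHom ((intervalSpace K I a).subtype.smulRight (x a))
      naturality := fun a b f => by
        apply FGModuleCat.hom_ext
        refine LinearMap.ext fun (c : intervalSpace K I a) => ?_
        change ((intervalMap K I a b c : intervalSpace K I b) : K) • x b =
          transition F (leOfHom f) ((c : K) • x a)
        rw [map_smul]
        by_cases ha : a ∈ I
        · rw [hx (leOfHom f) ha]
          by_cases hb : b ∈ I
          · rw [coe_intervalMap K ha hb]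
          · simp [hx0 b hb]
        · rw [intervalMap_eq_zero K fun h => ha h.1, hzero a ha c]
          simp }
  let p : F ⟶ intervalDiagram K I hI :=
    { app := fun a => FGModuleCat.ofHom ((φ a).codRestrict (intervalSpace K I a) (hmem a))
      naturality := fun a b f => by
        apply FGModuleCat.hom_ext
        refine LinearMap.ext fun (v : F.obj a) => Subtype.ext ?_
        change φ b (transition F (leOfHom f) v) = ((intervalMap K I a b ⟨φ a v, hmem a v⟩ :
          intervalSpace K I b) : K)
        by_cases hb : b ∈ I
        · rw [← LinearMap.comp_apply, hφ (leOfHom f) hb]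
          by_cases ha : a ∈ I
          · rw [coe_intervalMap K ha hb]
          · rw [intervalMap_eq_zero K fun h => ha h.1]
            simp [hφ0 a ha]
        · rw [intervalMap_eq_zero K fun h => hb h.2, hφ0 b hb]
          simp }
  refine ⟨i, p, ?_, fun a ha => ?_⟩
  · apply NatTrans.ext
    funext a
    apply FGModuleCat.hom_ext
    refine LinearMap.ext fun (c : intervalSpace K I a) => Subtype.ext ?_
    change φ a ((c : K) • x a) = (c : K)
    by_cases ha : a ∈ I
    · rw [map_smul, h1 a ha, smul_eq_mul, mul_one]
    · rw [hzero a ha c, zero_smul, map_zero]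
  · refine ⟨(⟨1, by rw [intervalSpace_of_mem K ha]; trivial⟩ : intervalSpace K I a), ?_⟩
    change (1 : K) • x a = x a
    rw [one_smul]

/-- A nonzero diagram that is constant on the level sets of a bounded monotone function has an
interval diagram as a retract. -/
theorem exists_retract_of_ne_zero {r : ℝ → ℕ} {m : ℕ} (hr : Monotone r) (hm : ∀ a, r a < m)
    (hF : ∀ ⦃a b : ℝ⦄ (h : a ≤ b), r a = r b → IsIso (F.map (homOfLE h)))
    (hne : ∃ (a : ℝ) (y : F.obj a), y ≠ 0) :
    ∃ (I : Set ℝ) (hI : I.OrdConnected) (i : intervalDiagram K I hI ⟶ F)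
      (p : F ⟶ intervalDiagram K I hI), i ≫ p = 𝟙 _ ∧
      ∃ (a : ℝ) (y : F.obj a), y ≠ 0 ∧ y ∈ LinearMap.range (i.app a).hom.hom := by
  classical
  obtain ⟨S, hS, hScomp⟩ := exists_slide F hr hF
  let T : ∀ a b : ℝ, r a ≤ r b → (F.obj a →ₗ[K] F.obj b) := fun a b h => (S a b h).hom.hom
  have hT : ∀ a b h (hab : a ≤ b), T a b h = transition F hab := fun a b h hab => by
    simp only [T, hS a b h hab, transition]
  have hTcomp : ∀ a b c hab hbc (v : F.obj a), T b c hbc (T a b hab v) = T a c (hab.trans hbc) v :=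
    fun a b c hab hbc v => by
      simp only [T]
      rw [← hScomp a b c hab hbc]
      rfl
  -- Minimality of the level makes `F` vanish below it, so the functional may be cut off there
  -- without losing coherence.
  obtain ⟨a₀, ⟨y, hy⟩, hmin⟩ : ∃ a₀, (∃ y : F.obj a₀, y ≠ 0) ∧
      ∀ b, r b < r a₀ → ∀ z : F.obj b, z = 0 := by
    have hex : ∃ k a, r a = k ∧ ∃ y : F.obj a, y ≠ 0 := by
      obtain ⟨a, hya⟩ := hne
      exact ⟨r a, a, rfl, hya⟩
    obtain ⟨a, hra, hya⟩ := Nat.find_spec hex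
    refine ⟨a, hya, fun b hb z => ?_⟩
    by_contra hz
    exact Nat.find_min hex (hra ▸ hb) ⟨b, rfl, z, hz⟩
  let x : ∀ b, F.obj b := fun b => if h : r a₀ ≤ r b then T a₀ b h y else 0
  have hxT : ∀ b (h : r a₀ ≤ r b), x b = T a₀ b h y := fun b h => dif_pos h
  let I : Set ℝ := {b | x b ≠ 0}
  have hIr : ∀ b ∈ I, r a₀ ≤ r b := fun b hb => by
    by_contra h
    exact hb (dif_neg h)
  have hxx : ∀ b c (hb : r a₀ ≤ r b) (hbc : r b ≤ r c), T b c hbc (x b) = x c :=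
    fun b c hb hbc => by rw [hxT b hb, hxT c (hb.trans hbc), hTcomp]
  have hIdown : ∀ b c, r a₀ ≤ r b → r b ≤ r c → c ∈ I → b ∈ I := fun b c hb hbc hc h0 => by
    refine hc ?_
    rw [← hxx b c hb hbc, h0, map_zero]
  have hI : I.OrdConnected := ⟨fun b hb d hd c hc =>
    hIdown c d ((hIr b hb).trans (hr hc.1)) (hr hc.2) hd⟩
  have ha₀ : a₀ ∈ I := by
    have h0 : x a₀ = y := by
      rw [hxT a₀ le_rfl, hT a₀ a₀ _ le_rfl]
      simp [transition]
    change x a₀ ≠ 0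
    rwa [h0]
  -- `I` need not have a greatest element, but the bounded function `r` attains a maximum on it, and
  -- slides reach `d` from all of `I`.
  obtain ⟨d, hd, hmax⟩ : ∃ d ∈ I, ∀ b ∈ I, r b ≤ r d := by
    have hbdd : (r '' I).Finite := (Set.finite_Iio m).subset (by rintro _ ⟨a, -, rfl⟩; exact hm a)
    obtain ⟨_, ⟨d, hd, rfl⟩, hdm⟩ := Set.exists_max_image (r '' I) id hbdd ⟨_, a₀, ha₀, rfl⟩
    exact ⟨d, hd, fun b hb => hdm _ ⟨b, hb, rfl⟩⟩
  obtain ⟨ψ, hψ⟩ := Module.Projective.exists_dual_eq_one K (show x d ≠ 0 from hd)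
  let φ : ∀ b, F.obj b →ₗ[K] K := fun b => if h : b ∈ I then ψ ∘ₗ T b d (hmax b h) else 0
  have hφT : ∀ b (h : b ∈ I), φ b = ψ ∘ₗ T b d (hmax b h) := fun b h => dif_pos h
  obtain ⟨i, p, hip, hrange⟩ := exists_retract_intervalDiagram F hI x φ
    (fun a ha => not_not.1 ha) (fun a ha => dif_neg ha)
    (fun a b h ha => by rw [← hT a b (hr h) h, hxx a b (hIr a ha)])
    (fun a b h hb => by
      by_cases ha : a ∈ I
      · rw [hφT a ha, hφT b hb, ← hT a b (hr h) h]
        ext v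
        simp only [LinearMap.comp_apply, hTcomp]
      · have hlt : r a < r a₀ := by
          by_contra hge
          exact ha (hIdown a b (not_lt.1 hge) (hr h) hb)
        ext v
        rw [hmin a hlt v, map_zero, map_zero])
    (fun a ha => by rw [hφT a ha, LinearMap.comp_apply, hxx a d (hIr a ha), hψ])
  exact ⟨I, hI, i, p, hip, a₀, x a₀, ha₀, hrange a₀ ha₀⟩

end Retract

/-! ### Induction on total dimension. -/

section Decomposition

variable {K : Type u} [Field K]

theorem HasFiniteType.of_forall_eq_zero (F : Diagram K) (h : ∀ (a : ℝ) (y : F.obj a), y = 0) :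
    HasFiniteType F := by
  have hz : ∀ {G H : Diagram K} (f g : G ⟶ H), (∀ (a : ℝ) (y : H.obj a), y = 0) → f = g := by
    intro G H f g h0
    apply NatTrans.ext
    funext a
    apply FGModuleCat.hom_ext
    refine LinearMap.ext fun v => ?_
    rw [h0 a ((f.app a).hom.hom v), h0 a ((g.app a).hom.hom v)]
  refine ⟨0, Fin.elim0, fun k => k.elim0, ⟨⟨0, 0, hz _ _ h, ?_⟩⟩⟩
  exact biproduct.hom_ext _ _ fun k => k.elim0

/-- Since `q ≫ j` and `p ≫ i` are complementary idempotents, the cross terms `i ≫ q` and `j ≫ p`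
vanish, and `F` is the direct sum of `D 0` and `G`. -/
theorem nonempty_iso_biproduct_succ {C : Type v} [Category.{w} C] [Preadditive C]
    [HasFiniteBiproducts C] {N : ℕ} (D : Fin (N + 1) → C) {F G : C}
    {i : D 0 ⟶ F} {p : F ⟶ D 0} (hip : i ≫ p = 𝟙 _)
    {j : G ⟶ F} {q : F ⟶ G} (hjq : j ≫ q = 𝟙 _) (hqj : q ≫ j = 𝟙 _ - p ≫ i)
    (e : G ≅ ⨁ fun k : Fin N => D k.succ) : Nonempty (F ≅ ⨁ D) := by
  have hiq : i ≫ q = 0 := by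
    rw [← Category.comp_id (i ≫ q), ← hjq, Category.assoc, ← Category.assoc q, hqj]
    simp [reassoc_of% hip]
  have hjp : j ≫ p = 0 := by
    rw [← Category.id_comp (j ≫ p), ← hjq, Category.assoc, ← Category.assoc q, hqj]
    simp [hip]
  let P : ∀ k, F ⟶ D k := Fin.cons p fun k => q ≫ e.hom ≫ biproduct.π (fun k => D k.succ) k
  let Q : ∀ k, D k ⟶ F := Fin.cons i fun k => biproduct.ι (fun k => D k.succ) k ≫ e.inv ≫ j
  refine ⟨⟨biproduct.lift P, biproduct.desc Q, ?_, ?_⟩⟩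
  · have : ∑ k, (q ≫ e.hom ≫ biproduct.π (fun k => D k.succ) k) ≫
        biproduct.ι _ k ≫ e.inv ≫ j = q ≫ e.hom ≫ (∑ k, biproduct.π
          (fun k => D k.succ) k ≫ biproduct.ι _ k) ≫ e.inv ≫ j := by
      simp only [Preadditive.comp_sum, Preadditive.sum_comp, Category.assoc]
    rw [biproduct.lift_desc, Fin.sum_univ_succ]
    simp only [P, Q, Fin.cons_zero, Fin.cons_succ]
    rw [this, biproduct.total, Category.id_comp, e.hom_inv_id_assoc, hqj]
    abel
  · refine biproduct.hom_ext' _ _ fun k => biproduct.hom_ext _ _ fun l => ?_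
    rw [← Category.assoc, biproduct.ι_desc, Category.assoc, biproduct.lift_π, Category.comp_id]
    induction k using Fin.cases with
    | zero =>
      induction l using Fin.cases with
      | zero => rw [biproduct.ι_π_self]; exact hip
      | succ l =>
        rw [biproduct.ι_π_ne _ (Fin.succ_ne_zero l).symm]
        simp only [P, Q, Fin.cons_zero, Fin.cons_succ]
        rw [← Category.assoc, hiq, zero_comp]
    | succ k =>
      induction l using Fin.cases with
      | zero =>
        rw [biproduct.ι_π_ne _ (Fin.succ_ne_zero k)]
        simp only [P, Q, Fin.cons_zero, Fin.cons_succ, Category.assoc, hjp, comp_zero]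
      | succ l =>
        simp only [P, Q, Fin.cons_succ, Category.assoc, reassoc_of% hjq, e.inv_hom_id_assoc]
        by_cases hkl : k = l
        · subst hkl
          rw [biproduct.ι_π_self, biproduct.ι_π_self]
        · rw [biproduct.ι_π_ne _ hkl, biproduct.ι_π_ne _ fun h => hkl (Fin.succ_injective _ h)]

theorem HasFiniteType.of_retract {F G : Diagram K} {I : Set ℝ} {hI : I.OrdConnected}
    {i : intervalDiagram K I hI ⟶ F} {p : F ⟶ intervalDiagram K I hI} (hip : i ≫ p = 𝟙 _)
    {j : G ⟶ F} {q : F ⟶ G} (hjq : j ≫ q = 𝟙 _) (hqj : q ≫ j = 𝟙 _ - p ≫ i)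
    (hG : HasFiniteType G) : HasFiniteType F := by
  obtain ⟨N, J, hJ, ⟨e⟩⟩ := hG
  have hI' : ∀ k, ((Fin.cons I J : Fin (N + 1) → Set ℝ) k).OrdConnected := Fin.cases hI hJ
  exact ⟨N + 1, Fin.cons I J, hI', nonempty_iso_biproduct_succ
    (fun k => intervalDiagram K ((Fin.cons I J : Fin (N + 1) → Set ℝ) k) (hI' k))
    (i := i) (p := p) hip hjq hqj e⟩

/-- A diagram that is constant on the level sets of a bounded monotone function has finite
type. -/
theorem HasFiniteType.of_monotone {r : ℝ → ℕ} {m : ℕ} (hr : Monotone r) (hm : ∀ a, r a < m)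
    (F : Diagram K)
    (hF : ∀ ⦃a b : ℝ⦄ (h : a ≤ b), r a = r b → IsIso (F.map (homOfLE h))) :
    HasFiniteType F := by
  -- One sample point per level. A level missed by `r` gets an arbitrary point, which is harmless:
  -- the dimension of a retract is no larger at any point.
  let s : ℕ → ℝ := Function.invFun r
  have hs : ∀ a, r (s (r a)) = r a := fun a => Function.invFun_eq ⟨a, rfl⟩
  induction hn : ∑ k ∈ Finset.range m, Module.finrank K (F.obj (s k)) using
    Nat.strong_induction_on generalizing F with
  | _ n ih =>
  by_cases h0 : ∀ (a : ℝ) (y : F.obj a), y = 0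
  · exact .of_forall_eq_zero F h0
  push Not at h0
  obtain ⟨I, hI, i, p, hip, a, y, hy, hyi⟩ := exists_retract_of_ne_zero F hr hm hF h0
  obtain ⟨G, j, q, hjq, hqj⟩ := IsIdempotentComplete.idempotents_split F (𝟙 F - p ≫ i)
    (Idempotents.idem_of_id_sub_idem (p ≫ i) (by simp [reassoc_of% hip]))
  have hjq_app : ∀ b (v : G.obj b), (q.app b).hom.hom ((j.app b).hom.hom v) = v := fun b v => by
    have := congrArg (fun t : G ⟶ G => (t.app b).hom.hom v) hjq
    exact this
  have hinj : ∀ b, Function.Injective (j.app b).hom.hom := fun b =>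
    Function.LeftInverse.injective (hjq_app b)
  have hG : ∀ ⦃a b : ℝ⦄ (h : a ≤ b), r a = r b → IsIso (G.map (homOfLE h)) := fun b c h hbc => by
    have := hF h hbc
    have h1 : ∀ c, j.app c ≫ q.app c = 𝟙 _ := fun c => congrArg (fun t : G ⟶ G => t.app c) hjq
    refine ⟨j.app c ≫ inv (F.map (homOfLE h)) ≫ q.app b, ?_, ?_⟩
    · rw [← Category.assoc, j.naturality]
      simp [h1]
    · rw [Category.assoc, Category.assoc, ← q.naturality, IsIso.inv_hom_id_assoc, h1]
  refine .of_retract hip hjq hqj (ih _ ?_ G hG rfl)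
  rw [← hn]
  refine Finset.sum_lt_sum (fun k _ => LinearMap.finrank_le_finrank_of_injective (hinj (s k)))
    ⟨r a, Finset.mem_range.2 (hm a), ?_⟩
  have hfr : ∀ H : Diagram K,
      (∀ ⦃a b : ℝ⦄ (h : a ≤ b), r a = r b → IsIso (H.map (homOfLE h))) →
      Module.finrank K (H.obj (s (r a))) = Module.finrank K (H.obj a) := by
    intro H hH
    rcases le_total (s (r a)) a with h | h
    · have := hH h (hs a)
      exact (FGModuleCat.isoToLinearEquiv (asIso (H.map (homOfLE h)))).finrank_eq
    · have := hH h (hs a).symm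
      exact (FGModuleCat.isoToLinearEquiv (asIso (H.map (homOfLE h)))).finrank_eq.symm
  rw [hfr F hF, hfr G hG, ← LinearMap.finrank_range_of_inj (hinj a)]
  -- If `j` were onto at `a`, then `y = j z`. But `y` also comes from `i`, and `i ≫ q = 0`, so `z =
  -- q (j z) = 0`, contradicting `y ≠ 0`.
  refine Submodule.finrank_lt fun htop => hy ?_
  obtain ⟨z, rfl⟩ : y ∈ LinearMap.range (j.app a).hom.hom := htop ▸ Submodule.mem_top
  obtain ⟨c, hc⟩ := hyi
  have hiq : i ≫ q = 0 := by
    rw [← Category.comp_id (i ≫ q), ← hjq, Category.assoc, ← Category.assoc q, hqj]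
    simp [reassoc_of% hip]
  have h2 : (q.app a).hom.hom ((i.app a).hom.hom c) = 0 :=
    congrArg (fun t : intervalDiagram K I hI ⟶ G => (t.app a).hom.hom c) hiq
  rw [hc, hjq_app] at h2
  rw [h2, map_zero]

end Decomposition

/-! ### Finite type implies tame. -/

section FiniteType

theorem frontier_subset_pair {s : Set ℝ} {a b : ℝ} (h : Set.Ioo a b ⊆ s) (h' : s ⊆ Set.Icc a b) :
    frontier s ⊆ {a, b} := by
  rintro x ⟨hx, hx'⟩
  obtain ⟨hax, hxb⟩ := closure_minimal h' isClosed_Icc hx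
  by_contra hne
  simp only [Set.mem_insert_iff, Set.mem_singleton_iff, not_or] at hne
  exact hx' (interior_maximal h isOpen_Ioo ⟨hax.lt_of_ne' hne.1, hxb.lt_of_ne hne.2⟩)

/-- By the classification of connected subsets of `ℝ`, the only possible frontier points are `sInf
I` and `sSup I`; their junk values for unbounded or empty `I` only enlarge the finite bounding set.
-/
theorem finite_frontier_of_ordConnected {I : Set ℝ} (hI : I.OrdConnected) :
    (frontier I).Finite := by
  refine Set.Finite.subset (Set.toFinite {sInf I, sSup I}) ?_
  have h := hI.isPreconnected.mem_intervals
  generalize sInf I = a at *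
  generalize sSup I = b at *
  simp only [Set.mem_insert_iff, Set.mem_singleton_iff] at h
  rcases h with rfl | rfl | rfl | rfl | rfl | rfl | rfl | rfl | rfl | rfl
  · exact frontier_subset_pair Set.Ioo_subset_Icc_self subset_rfl
  · exact frontier_subset_pair Set.Ioo_subset_Ico_self Set.Ico_subset_Icc_self
  · exact frontier_subset_pair Set.Ioo_subset_Ioc_self Set.Ioc_subset_Icc_self
  · exact frontier_subset_pair subset_rfl Set.Ioo_subset_Icc_self
  all_goals simp

variable {K : Type u} [Field K]

theorem isIso_intervalDiagram_map {I : Set ℝ} (hI : I.OrdConnected) {a b : ℝ} (h : a ≤ b)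
    (hab : a ∈ I ↔ b ∈ I) : IsIso ((intervalDiagram K I hI).map (homOfLE h)) := by
  have key : ∀ {a b : ℝ}, (a ∈ I ↔ b ∈ I) →
      intervalMap K I b a ∘ₗ intervalMap K I a b = LinearMap.id := by
    intro a b hab
    ext c
    rw [LinearMap.comp_apply]
    by_cases ha : a ∈ I
    · rw [coe_intervalMap K (hab.1 ha) ha, coe_intervalMap K ha (hab.1 ha)]
      rfl
    · have hc : (c : K) = 0 := (Submodule.mem_bot K).1 ((intervalSpace_of_notMem K ha).le c.2)
      rw [intervalMap_eq_zero K fun h => ha h.1]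
      simp [hc]
  exact ⟨FGModuleCat.ofHom (intervalMap K I b a), FGModuleCat.hom_ext (key hab),
    FGModuleCat.hom_ext (key hab.symm)⟩

/-- The inverse is the sum of the inverses on the summands, transported along the projections and
inclusions. -/
theorem isIso_map_of_iso_biproduct {F : Diagram K} {N : ℕ} {D : Fin N → Diagram K}
    (e : F ≅ ⨁ D) {a b : ℝ} (h : a ≤ b) (hD : ∀ k, IsIso ((D k).map (homOfLE h))) :
    IsIso (F.map (homOfLE h)) := by
  let P : ∀ k, F ⟶ D k := fun k => e.hom ≫ biproduct.π D k
  let Q : ∀ k, D k ⟶ F := fun k => biproduct.ι D k ≫ e.inv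
  have htotal : ∑ k, P k ≫ Q k = 𝟙 F := by
    have : ∑ k, P k ≫ Q k = e.hom ≫ (∑ k, biproduct.π D k ≫ biproduct.ι D k) ≫ e.inv := by
      simp only [P, Q, Preadditive.comp_sum, Preadditive.sum_comp, Category.assoc]
    rw [this, biproduct.total, Category.id_comp, e.hom_inv_id]
  have happ : ∀ c, ∑ k, (P k).app c ≫ (Q k).app c = 𝟙 (F.obj c) := fun c => by
    have := congrArg (fun t : F ⟶ F => t.app c) htotal
    simpa [NatTrans.app_sum] using this
  refine ⟨∑ k, (P k).app b ≫ inv ((D k).map (homOfLE h)) ≫ (Q k).app a, ?_, ?_⟩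
  · rw [← happ a, Preadditive.comp_sum]
    refine Finset.sum_congr rfl fun k _ => ?_
    rw [← Category.assoc, (P k).naturality, Category.assoc, IsIso.hom_inv_id_assoc]
  · rw [← happ b, Preadditive.sum_comp]
    refine Finset.sum_congr rfl fun k _ => ?_
    rw [Category.assoc, Category.assoc, ← (Q k).naturality, IsIso.inv_hom_id_assoc]

theorem HasFiniteType.isTame {F : Diagram K} (hF : HasFiniteType F) : IsTame F := by
  obtain ⟨N, I, hI, ⟨e⟩⟩ := hF
  refine (Set.finite_iUnion fun k => finite_frontier_of_ordConnected (hI k)).subset fun a ha => ?_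
  by_contra hfr
  refine ha ?_
  -- Off the frontier, membership in each `I k` is locally constant, and finitely many
  -- neighbourhoods can be intersected.
  have hev : ∀ᶠ b in nhds a, ∀ k, (b ∈ I k ↔ a ∈ I k) := by
    rw [Filter.eventually_all]
    intro k
    have hk : a ∉ frontier (I k) := fun h => hfr (Set.mem_iUnion.2 ⟨k, h⟩)
    by_cases hak : a ∈ I k
    · have : a ∈ interior (I k) := by
        by_contra hint
        exact hk ⟨subset_closure hak, hint⟩
      filter_upwards [mem_interior_iff_mem_nhds.1 this] with b hb
      exact iff_of_true hb hak
    · have : a ∈ (closure (I k))ᶜ := fun hcl => hk ⟨hcl, fun hint => hak (interior_subset hint)⟩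
      filter_upwards [isClosed_closure.isOpen_compl.mem_nhds this] with b hb
      exact iff_of_false (fun h => hb (subset_closure h)) hak
  obtain ⟨l, u, ha, hlu⟩ := mem_nhds_iff_exists_Ioo_subset.1 hev
  refine ⟨Set.Ioo l u, Set.ordConnected_Ioo, isOpen_Ioo, ha, fun b c h hb hc => ?_⟩
  exact isIso_map_of_iso_biproduct e h fun k =>
    isIso_intervalDiagram_map (hI k) h ((hlu hb k).trans (hlu hc k).symm)

end FiniteType

end Persistence

theorem mainTheorem2 {K : Type*} [Field K] (F : Persistence.Diagram K) :
    Persistence.IsTame F ↔ Persistence.HasFiniteType F := by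
  refine ⟨fun h => ?_, fun h => h.isTame⟩
  obtain ⟨r, m, hr, hm, hF⟩ := h.exists_monotone
  exact .of_monotone hr hm F hF
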